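/- Let $m\ge 1$, $N_1,\dots,N_m\ge 1$, let $\mathcal A=(a_{j_1\cdots j_m})\in\mathbb R_+^{N_1\times\cdots\times N_m}$ be an entrywise nonnegative tensor, and let $\sigma=\{\sigma_i\}_{i=1}^d$ be a shape partition of $\mathcal A$, i.e. a partition of $\{1,\dots,m\}$ into nonempty blocks such that $N_j=N_{j'}$ for $j,j'\in\sigma_i$, $j\le k$ for $j\in\sigma_i,\ k\in\sigma_{i+1}$, and $|\sigma_i|\le|\sigma_{i+1}|$. Put $s_i=\min\sigma_i$, $n_i=N_{s_i}$, $\mathbb R^\sigma=\mathbb R^{n_1}\times\cdots\times\mathbb R^{n_d}$, let $\mathbb R^\sigma_{++}$ be the set of its vectors with all entries positive, and for $x=(x_1,\dots,x_d)\in\mathbb R^\sigma$ let $x^{[\sigma]}\in\mathbb R^{N_1}\times\cdots\times\mathbb R^{N_m}$ have $l$-th component $x_i$ whenever $l\in\sigma_i$. Write $$\mathscr A_{i,t}(z_1,\dots,z_m)=\sum_{j_1,\dots,j_m:\ j_i=t}a_{j_1\cdots j_m}\prod_{l\ne i}z_{l,j_l},\qquad \mathscr A_i=(\mathscr A_{i,1},\dots,\mathscr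 A_{i,N_i}).$$ Let $p=(p_1,\dots,p_d)\in(1,\infty)^d$. A $(\sigma,p)$-eigenpair of $\mathcal A$ is a pair $(\lambda,x)\in\mathbb R\times\mathbb R^\sigma$ with $\mathscr A_{s_i,t}(x^{[\sigma]})=\lambda|x_{i,t}|^{p_i-1}\operatorname{sign}(x_{i,t})$ and $\|x_i\|_{p_i}=1$ for all $i\in\{1,\dots,d\}$, $t\in\{1,\dots,n_i\}$; then $\lambda$ is called a $(\sigma,p)$-eigenvalue and $x$ a $(\sigma,p)$-eigenvector. Let $r=r^{(\sigma,p)}(\mathcal A)$ be the supremum of $|\lambda|$ over all $(\sigma,p)$-eigenvalues $\lambda$. The tensor $\mathcal A$ is $\sigma$-strictly nonnegative if the matrix with entries $\frac{\partial}{\partial x_{j,l}}\mathscr A_{s_i,t}(x^{[\sigma]})\big|_{x=\mathbf 1}$ (rows $(i,t)$, columns $(j,l)$) has at least one nonzero entry in every row. For $x\in\mathbb R^\sigma_{++}$ and $y\in\mathbb R^\sigma$ put $$\Phi_{i,t}(x)=\frac{\mathscr A_{s_i,t}(x^{[\sigma]})}{x_{i,t}^{p_i-1}},\quad \phi(x)=\max_{i,t}\Phi_{i,t}(x),\quad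 c(x)=\prod_{i=1}^d\|x_i\|_{p_i},\quad F_{i,t}(y)=\log\Phi_{i,t}(e^y),\quad g(y)=\log c(e^y),$$ with $e^y$ (and $\log x$ below) taken entrywise. **Theorem.** Suppose that $\mathcal A$ is $\sigma$-strictly nonnegative and $\sum_{i=1}^d|\sigma_i|/p_i<1$. Then $r$ is the supremum of a nonempty bounded set, $r>0$, and $\mathcal A$ has a unique positive $(\sigma,p)$-eigenvector $\bar x\in\mathbb R^\sigma_{++}$. Moreover: (i) The problem $\min\{\phi(x): x\in\mathbb R^\sigma_{++},\ c(x)\le 1\}$ has $\bar x$ as its unique solution, with optimal value $\phi(\bar x)=r$. (ii) The functions $F_{i,t}$ and $g$ are convex on $\mathbb R^\sigma$, so that $$\min\{\mu:\ (y,\mu)\in\mathbb R^\sigma\times\mathbb R,\ F_{i,t}(y)-\mu\le 0\ \text{for all } i,t,\ g(y)\le 0\}$$ is a convex program, and its unique solution is $(\bar y,\bar\mu)=(\log\bar x,\log r)$. -/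

import Mathlib

noncomputable section

namespace SigmaP

/-- A real tensor of order `m` and dimensions `N 0 × ⋯ × N (m-1)`. -/
abbrev Tensor {m : ℕ} (N : Fin m → ℕ) : Type := (∀ l : Fin m, Fin (N l)) → ℝ

/-- The component `𝒜_{i,t}(z₁, …, z_m)` of the gradient of the multilinear form of `A`:
the sum of `a_{k₁⋯k_m} ∏_{l ≠ i} z_{l,k_l}` over all multi-indices `k` with `k_i = t`. -/
def gradForm {m : ℕ} {N : Fin m → ℕ} (A : Tensor N) (i : Fin m) (t : Fin (N i))
    (z : ∀ l : Fin m, Fin (N l) → ℝ) : ℝ :=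
  ∑ k : (∀ l : Fin m, Fin (N l)) with k i = t, A k * ∏ l ∈ Finset.univ.erase i, z l (k l)

/-- A shape partition with `d` blocks of the index set of a tensor with dimensions `N`. -/
structure ShapePartition {m : ℕ} (N : Fin m → ℕ) (d : ℕ) where
  block : Fin d → Finset (Fin m)
  block_nonempty : ∀ i, (block i).Nonempty
  block_disjoint : ∀ i j, i ≠ j → Disjoint (block i) (block j)
  block_cover : ∀ l : Fin m, ∃ i, l ∈ block i
  dim_eq : ∀ i, ∀ j ∈ block i, ∀ j' ∈ block i, N j = N j'
  block_ordered : ∀ i i' : Fin d, (i : ℕ) + 1 = (i' : ℕ) →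
    ∀ j ∈ block i, ∀ k ∈ block i', j ≤ k
  card_mono : ∀ i i' : Fin d, (i : ℕ) + 1 = (i' : ℕ) → (block i).card ≤ (block i').card

namespace ShapePartition

variable {m : ℕ} {N : Fin m → ℕ} {d : ℕ} (σ : ShapePartition N d)

/-- `s_i = min σ_i`. -/
def first (i : Fin d) : Fin m := (σ.block i).min' (σ.block_nonempty i)

/-- `n_i = N_{s_i}`. -/
def dim (i : Fin d) : ℕ := N (σ.first i)

/-- The block to which an index belongs. -/
def blockOf (l : Fin m) : Fin d := Classical.choose (σ.block_cover l)

theorem mem_blockOf (l : Fin m) : l ∈ σ.block (σ.blockOf l) :=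
  Classical.choose_spec (σ.block_cover l)

theorem dim_blockOf (l : Fin m) : N l = σ.dim (σ.blockOf l) :=
  σ.dim_eq _ _ (σ.mem_blockOf l) _ (Finset.min'_mem _ _)

/-- `ℝ^σ = ℝ^{n_1} × ⋯ × ℝ^{n_d}`. -/
abbrev Vec : Type := ∀ i : Fin d, Fin (σ.dim i) → ℝ

/-- `x ∈ ℝ^σ_{++}`: all entries of `x` are positive. -/
def Pos (x : σ.Vec) : Prop := ∀ i t, 0 < x i t

/-- `x^{[σ]}`: the vector whose `l`-th component is `x_i` for the block `σ_i` containing `l`. -/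
def lift (x : σ.Vec) : ∀ l : Fin m, Fin (N l) → ℝ :=
  fun l k => x (σ.blockOf l) (Fin.cast (σ.dim_blockOf l) k)

/-- `𝒜_{s_i,t}(x^{[σ]})`. -/
def G (A : Tensor N) (x : σ.Vec) (i : Fin d) (t : Fin (σ.dim i)) : ℝ :=
  gradForm A (σ.first i) t (σ.lift x)

/-- The matrix of the partial derivatives of `𝒜_{s_i,t}(x^{[σ]})` with respect to `x_{j,l}`,
evaluated at the all-ones vector. -/
def jacobianAtOne (A : Tensor N) :
    Matrix ((i : Fin d) × Fin (σ.dim i)) ((i : Fin d) × Fin (σ.dim i)) ℝ :=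
  fun a b => deriv
    (fun τ : ℝ => σ.G A
      (Function.update (1 : σ.Vec) b.1 (Function.update (1 : Fin (σ.dim b.1) → ℝ) b.2 τ))
      a.1 a.2) 1

/-- `σ`-strict nonnegativity (of an entrywise nonnegative tensor). -/
def StrictlyNonneg (A : Tensor N) : Prop :=
  ∀ a, ∃ b, σ.jacobianAtOne A a b ≠ 0

end ShapePartition

/-- The `ℓ_p`-norm on `ℝ^n`. -/
def pNorm {n : ℕ} (p : ℝ) (x : Fin n → ℝ) : ℝ := (∑ t, |x t| ^ p) ^ (1 / p)

section Eigen

variable {m : ℕ} {N : Fin m → ℕ} {d : ℕ} (σ : ShapePartition N d) (A : Tensor N)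
  (p : Fin d → ℝ)

/-- `(lam, x)` is a `(σ, p)`-eigenpair of `A`. -/
def IsEigenpair (lam : ℝ) (x : σ.Vec) : Prop :=
  (∀ i t, σ.G A x i t = lam * (|x i t| ^ (p i - 1) * Real.sign (x i t))) ∧
    ∀ i, pNorm (p i) (x i) = 1

/-- `x` is a (strictly) positive `(σ, p)`-eigenvector of `A`. -/
def IsPosEigenvector (x : σ.Vec) : Prop :=
  σ.Pos x ∧ ∃ lam : ℝ, IsEigenpair σ A p lam x

/-- The set of the absolute values of the `(σ, p)`-eigenvalues of `A`. -/
def absEigenvalues : Set ℝ :=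
  {r | ∃ (lam : ℝ) (x : σ.Vec), IsEigenpair σ A p lam x ∧ r = |lam|}

/-- The `(σ, p)`-spectral radius `r^{(σ,p)}(A)`. -/
def spectralRadius : ℝ := sSup (absEigenvalues σ A p)

/-- `Φ_{i,t}(x) = 𝒜_{s_i,t}(x^{[σ]}) / x_{i,t}^{p_i - 1}` (for positive `x`). -/
def Phi (x : σ.Vec) (i : Fin d) (t : Fin (σ.dim i)) : ℝ :=
  σ.G A x i t / x i t ^ (p i - 1)

/-- `φ(x) = max_{i,t} Φ_{i,t}(x)`; the index set is finite. -/
def phi (x : σ.Vec) : ℝ := ⨆ q : (i : Fin d) × Fin (σ.dim i), Phi σ A p x q.1 q.2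

/-- `c(x) = ‖x_1‖_{p_1} ⋯ ‖x_d‖_{p_d}`. -/
def cFun (x : σ.Vec) : ℝ := ∏ i, pNorm (p i) (x i)

/-- Entrywise exponential. -/
def vexp (y : σ.Vec) : σ.Vec := fun i t => Real.exp (y i t)

/-- Entrywise logarithm. -/
def vlog (x : σ.Vec) : σ.Vec := fun i t => Real.log (x i t)

/-- `F(y) = log Φ(e^y)`. -/
def logPhi (y : σ.Vec) (i : Fin d) (t : Fin (σ.dim i)) : ℝ :=
  Real.log (Phi σ A p (vexp σ y) i t)

/-- `g(y) = log c(e^y)`. -/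
def logC (y : σ.Vec) : ℝ := Real.log (cFun σ p (vexp σ y))

/-- The feasible set of `min φ(x)` subject to `x ∈ ℝ^σ_{++}` and `c(x) ≤ 1`. -/
def feasible : Set σ.Vec := {x | σ.Pos x ∧ cFun σ p x ≤ 1}

/-- The feasible set of `min μ` over `(y, μ) ∈ ℝ^σ × ℝ` subject to `F(y) - μ 1 ≤ 0` and
`g(y) ≤ 0`. -/
def logFeasible : Set (σ.Vec × ℝ) :=
  {w | (∀ i t, logPhi σ A p w.1 i t - w.2 ≤ 0) ∧ logC σ p w.1 ≤ 0}

end Eigen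

/-- `x` is a (global) solution of the problem of minimizing `f` over `S`. -/
def IsSolution {X : Type*} (f : X → ℝ) (S : Set X) (x : X) : Prop :=
  x ∈ S ∧ ∀ z ∈ S, f x ≤ f z

end SigmaP

end

/-! Let `S = ∑ |σ_i| / p_i`. Multiplying block `i` by `τ ^ (1 / p i)` multiplies `Φ` by `τ ^ (S -
1)` in every component, so for `S < 1` any positive multiplier can be scaled to 1 and the eigenvalue
equation becomes `G x = x ^ (p - 1)`. In the coordinates `p_i log x_i` this is a fixed-point
equation for a sup-norm contraction of constant `S`, which gives existence.

Everything else rests on a comparison principle: nonnegative subsolutions lie below positive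
supersolutions. For any eigenvector `x`, a rescaling of `|x|` is a subsolution, so the positive
eigenvector carries the largest `|λ|`. A feasible `x` with `φ(x) ≤ r` dominates `xbar`; its norms
are then at least 1 with product at most 1, which forces `x = xbar`.

Convexity is that of log-sum-exp: in exponential coordinates, monomials are exponentials of linear
forms. -/

/-- The logarithm of a positive combination of exponentials of linear forms is convex. -/
theorem convexOn_log_sum_exp {E ι : Type*} [AddCommGroup E] [Module ℝ E] (s : Finset ι)
    (c : ι → ℝ) (hc : ∀ k ∈ s, 0 ≤ c k) (L : ι → E →ₗ[ℝ] ℝ)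
    (hpos : ∀ y, 0 < ∑ k ∈ s, c k * Real.exp (L k y)) :
    ConvexOn ℝ Set.univ (fun y => Real.log (∑ k ∈ s, c k * Real.exp (L k y))) := by
  refine ⟨convex_univ, fun y _ z _ a b ha hb hab => ?_⟩
  set U := Real.log (∑ k ∈ s, c k * Real.exp (L k y)) with hU
  set V := Real.log (∑ k ∈ s, c k * Real.exp (L k z)) with hV
  have normalized : ∀ w, ∑ k ∈ s, c k * Real.exp
      (L k w - Real.log (∑ k ∈ s, c k * Real.exp (L k w))) = 1 := fun w => by
    simp_rw [Real.exp_sub, Real.exp_log (hpos w), ← mul_div_assoc]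
    rw [← Finset.sum_div, div_self (hpos w).ne']
  simp only [smul_eq_mul]
  rw [Real.log_le_iff_le_exp (hpos _)]
  -- Subtracting `a * U + b * V` in the exponent normalizes both sums to 1, so termwise convexity of
  -- `exp` suffices.
  have key : ∑ k ∈ s, c k * Real.exp (L k (a • y + b • z) - (a * U + b * V)) ≤ 1 := by
    calc ∑ k ∈ s, c k * Real.exp (L k (a • y + b • z) - (a * U + b * V))
        ≤ ∑ k ∈ s, c k * (a * Real.exp (L k y - U) + b * Real.exp (L k z - V)) := by
          refine Finset.sum_le_sum fun k hk => mul_le_mul_of_nonneg_left ?_ (hc k hk)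
          have h := convexOn_exp.2 (Set.mem_univ (L k y - U)) (Set.mem_univ (L k z - V)) ha hb hab
          simp only [smul_eq_mul] at h
          convert h using 2
          simp only [map_add, map_smul, smul_eq_mul]
          ring
      _ = a * ∑ k ∈ s, c k * Real.exp (L k y - U) + b * ∑ k ∈ s, c k * Real.exp (L k z - V) := by
          rw [Finset.mul_sum, Finset.mul_sum, ← Finset.sum_add_distrib]
          exact Finset.sum_congr rfl fun k _ => by ring
      _ = 1 := by rw [normalized y, normalized z, mul_one, mul_one, hab]
  simp_rw [Real.exp_sub, ← mul_div_assoc] at key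
  rwa [← Finset.sum_div, div_le_one (Real.exp_pos _)] at key

namespace SigmaP

/-! ### Homogeneity and monotonicity of the norms. -/

section PNorm

variable {n : ℕ} {q : ℝ} {x y : Fin n → ℝ}

theorem pNorm_smul (hq : 0 < q) {a : ℝ} (ha : 0 ≤ a) (x : Fin n → ℝ) :
    pNorm q (fun t => a * x t) = a * pNorm q x := by
  unfold pNorm
  have h : ∀ t, |a * x t| ^ q = a ^ q * |x t| ^ q := fun t => by
    rw [abs_mul, abs_of_nonneg ha, Real.mul_rpow ha (abs_nonneg _)]
  simp_rw [h]
  rw [← Finset.mul_sum, Real.mul_rpow (Real.rpow_nonneg ha _)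
    (Finset.sum_nonneg fun t _ => Real.rpow_nonneg (abs_nonneg _) _), ← Real.rpow_mul ha,
    mul_one_div_cancel hq.ne', Real.rpow_one]

theorem pNorm_abs (q : ℝ) (x : Fin n → ℝ) : pNorm q (fun t => |x t|) = pNorm q x := by
  simp [pNorm]

theorem pNorm_mono (hq : 0 < q) (hx : ∀ t, 0 ≤ x t) (hxy : ∀ t, x t ≤ y t) :
    pNorm q x ≤ pNorm q y := by
  unfold pNorm
  refine Real.rpow_le_rpow (Finset.sum_nonneg fun t _ => Real.rpow_nonneg (abs_nonneg _) _)
    (Finset.sum_le_sum fun t _ => Real.rpow_le_rpow (abs_nonneg _) ?_ hq.le) (by positivity)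
  rw [abs_of_nonneg (hx t), abs_of_nonneg ((hx t).trans (hxy t))]
  exact hxy t

theorem pNorm_lt_pNorm (hq : 0 < q) (hx : ∀ t, 0 ≤ x t) (hxy : ∀ t, x t ≤ y t)
    {t₀ : Fin n} (ht₀ : x t₀ < y t₀) : pNorm q x < pNorm q y := by
  unfold pNorm
  refine Real.rpow_lt_rpow (Finset.sum_nonneg fun t _ => Real.rpow_nonneg (abs_nonneg _) _)
    (Finset.sum_lt_sum (fun t _ => Real.rpow_le_rpow (abs_nonneg _) ?_ hq.le)
      ⟨t₀, Finset.mem_univ _, Real.rpow_lt_rpow (abs_nonneg _) ?_ hq⟩) (by positivity)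
  · rw [abs_of_nonneg (hx t), abs_of_nonneg ((hx t).trans (hxy t))]
    exact hxy t
  · rw [abs_of_nonneg (hx t₀), abs_of_nonneg ((hx t₀).trans (hxy t₀))]
    exact ht₀

theorem sum_rpow_pos (hn : 0 < n) (hx : ∀ t, 0 < x t) : 0 < ∑ t, x t ^ q :=
  Finset.sum_pos (fun t _ => Real.rpow_pos_of_pos (hx t) _) ⟨⟨0, hn⟩, Finset.mem_univ _⟩

theorem pNorm_eq_of_pos (q : ℝ) (hx : ∀ t, 0 < x t) :
    pNorm q x = (∑ t, x t ^ q) ^ (1 / q) := by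
  unfold pNorm
  simp_rw [abs_of_pos (hx _)]

theorem pNorm_pos (hn : 0 < n) (hx : ∀ t, 0 < x t) : 0 < pNorm q x := by
  rw [pNorm_eq_of_pos q hx]
  exact Real.rpow_pos_of_pos (sum_rpow_pos hn hx) _

end PNorm

section GradForm

variable {m : ℕ} {N : Fin m → ℕ} {A : Tensor N} {i : Fin m} {t : Fin (N i)}
  {z : ∀ l : Fin m, Fin (N l) → ℝ}

theorem gradForm_eq_zero (h : ∀ k, k i = t → A k = 0) : gradForm A i t z = 0 :=
  Finset.sum_eq_zero fun k hk => by rw [h k (Finset.mem_filter.1 hk).2, zero_mul]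

theorem gradForm_pos (hA : ∀ k, 0 ≤ A k) (hz : ∀ l s, 0 < z l s) {k : ∀ l, Fin (N l)}
    (hk : k i = t) (hAk : 0 < A k) : 0 < gradForm A i t z :=
  Finset.sum_pos' (fun k _ => mul_nonneg (hA k) (Finset.prod_nonneg fun _ _ => (hz _ _).le))
    ⟨k, Finset.mem_filter.2 ⟨Finset.mem_univ _, hk⟩, mul_pos hAk
      (Finset.prod_pos fun _ _ => hz _ _)⟩

theorem sum_mul_gradForm (A : Tensor N) (i : Fin m) (z : ∀ l : Fin m, Fin (N l) → ℝ) :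
    ∑ t, z i t * gradForm A i t z = ∑ k, A k * ∏ l, z l (k l) := by
  rw [← Finset.sum_fiberwise (s := Finset.univ) (g := fun k : ∀ l, Fin (N l) => k i)]
  refine Finset.sum_congr rfl fun t _ => ?_
  unfold gradForm
  rw [Finset.mul_sum]
  refine Finset.sum_congr rfl fun k hk => ?_
  rw [← Finset.mul_prod_erase _ _ (Finset.mem_univ i), (Finset.mem_filter.1 hk).2]
  ring

end GradForm

variable {m : ℕ} {N : Fin m → ℕ} {d : ℕ} (σ : ShapePartition N d) (A : Tensor N)
  (p : Fin d → ℝ)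

/-! ### Blockwise scaling, comparison and existence. -/

namespace ShapePartition

theorem blockOf_eq {l : Fin m} {i : Fin d} (h : l ∈ σ.block i) : σ.blockOf l = i := by
  by_contra hne
  exact Finset.disjoint_left.1 (σ.block_disjoint _ _ hne) (σ.mem_blockOf l) h

theorem blockOf_first (i : Fin d) : σ.blockOf (σ.first i) = i :=
  σ.blockOf_eq (Finset.min'_mem _ _)

theorem mem_block_iff {l : Fin m} {i : Fin d} : l ∈ σ.block i ↔ σ.blockOf l = i :=
  ⟨σ.blockOf_eq, fun h => h ▸ σ.mem_blockOf l⟩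

theorem lift_first (x : σ.Vec) (i : Fin d) (t : Fin (σ.dim i)) :
    σ.lift x (σ.first i) t = x i t := by
  -- The block of `s_i` equals `i` only propositionally; generalizing it to `j` allows substitution
  -- through the cast.
  have aux : ∀ (j : Fin d) (_ : j = i) (h' : σ.dim i = σ.dim j),
      x j (Fin.cast h' t) = x i t := by
    rintro j rfl h'
    rfl
  exact aux _ (σ.blockOf_first i) _

/-- `∑ l, 1 / p_{i(l)}`, where `i(l)` is the block of `l`. -/
noncomputable def weight : ℝ := ∑ l, 1 / p (σ.blockOf l)

theorem weight_eq : σ.weight p = ∑ i, ((σ.block i).card : ℝ) / p i := by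
  unfold weight
  rw [← Finset.sum_fiberwise (s := Finset.univ) (g := σ.blockOf)]
  refine Finset.sum_congr rfl fun i _ => ?_
  have h : σ.block i = Finset.univ.filter (fun l => σ.blockOf l = i) := by
    ext l
    simp [σ.mem_block_iff]
  rw [h, Finset.sum_congr rfl (g := fun _ => 1 / p i)
    (fun l hl => by rw [(Finset.mem_filter.1 hl).2]), Finset.sum_const, nsmul_eq_mul,
    mul_one_div]

theorem sum_erase_first (i : Fin d) :
    ∑ l ∈ Finset.univ.erase (σ.first i), 1 / p (σ.blockOf l) = σ.weight p - 1 / p i := by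
  rw [weight, ← Finset.add_sum_erase _ _ (Finset.mem_univ (σ.first i)), σ.blockOf_first]
  ring

/-- The scaling of the `i`-th block by `τ ^ (1 / p i)`. -/
noncomputable def scale (τ : ℝ) (x : σ.Vec) : σ.Vec := fun i t => τ ^ (1 / p i) * x i t

variable {A p}

theorem scale_pos {τ : ℝ} (hτ : 0 < τ) {x : σ.Vec} (hx : σ.Pos x) : σ.Pos (σ.scale p τ x) :=
  fun i t => mul_pos (Real.rpow_pos_of_pos hτ _) (hx i t)

theorem G_mono (hA : ∀ k, 0 ≤ A k) {x y : σ.Vec} (hx : ∀ i t, 0 ≤ x i t)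
    (hxy : ∀ i t, x i t ≤ y i t) (i : Fin d) (t : Fin (σ.dim i)) : σ.G A x i t ≤ σ.G A y i t :=
  Finset.sum_le_sum fun k _ => mul_le_mul_of_nonneg_left
    (Finset.prod_le_prod (fun _ _ => hx _ _) fun _ _ => hxy _ _) (hA k)

theorem abs_G_le (hA : ∀ k, 0 ≤ A k) (x : σ.Vec) (i : Fin d) (t : Fin (σ.dim i)) :
    |σ.G A x i t| ≤ σ.G A (fun i t => |x i t|) i t := by
  refine (Finset.abs_sum_le_sum_abs _ _).trans (Finset.sum_le_sum fun k _ => ?_)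
  rw [abs_mul, abs_of_nonneg (hA k), Finset.abs_prod]
  rfl

theorem G_scale {τ : ℝ} (hτ : 0 < τ) (x : σ.Vec) (i : Fin d) (t : Fin (σ.dim i)) :
    σ.G A (σ.scale p τ x) i t = τ ^ (σ.weight p - 1 / p i) * σ.G A x i t := by
  unfold G gradForm
  rw [Finset.mul_sum, ← sum_erase_first, Real.rpow_sum_of_pos hτ]
  refine Finset.sum_congr rfl fun k _ => ?_
  have h : ∀ l, σ.lift (σ.scale p τ x) l (k l) =
      τ ^ (1 / p (σ.blockOf l)) * σ.lift x l (k l) := fun l => rfl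
  simp_rw [h]
  rw [Finset.prod_mul_distrib]
  ring

/-- If the slice had no positive entry, `G` would vanish identically in this component, and so would
its Jacobian row. -/
theorem exists_pos_entry (hA : ∀ k, 0 ≤ A k) (hstrict : σ.StrictlyNonneg A) (i : Fin d)
    (t : Fin (σ.dim i)) : ∃ k, k (σ.first i) = t ∧ 0 < A k := by
  by_contra! hne
  obtain ⟨b, hb⟩ := hstrict ⟨i, t⟩
  have hzero : ∀ x, σ.G A x i t = 0 := fun x =>
    gradForm_eq_zero fun k hk => le_antisymm (hne k hk) (hA k)
  refine hb ?_
  simp only [jacobianAtOne, hzero]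
  exact deriv_const _ _

theorem G_pos (hA : ∀ k, 0 ≤ A k) (hstrict : σ.StrictlyNonneg A) {x : σ.Vec} (hx : σ.Pos x)
    (i : Fin d) (t : Fin (σ.dim i)) : 0 < σ.G A x i t := by
  obtain ⟨k, hk, hAk⟩ := σ.exists_pos_entry hA hstrict i t
  exact gradForm_pos hA (fun _ _ => hx _ _) hk hAk

/-- The contraction of the gradient with any block is the full multilinear form. -/
theorem sum_mul_G (A : Tensor N) (x : σ.Vec) (i : Fin d) :
    ∑ t, x i t * σ.G A x i t = ∑ k, A k * ∏ l, σ.lift x l (k l) := by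
  rw [← sum_mul_gradForm A (σ.first i)]
  exact Finset.sum_congr rfl fun t _ => by rw [G, ← σ.lift_first x i t]

/-- The factor `τ ^ (weight - 1 / p i)` is the one in `G_scale` and cancels against it; what
remains, `τ ^ (1 - weight)`, does not depend on the block. -/
theorem scale_rpow (hp : ∀ i, 1 < p i) {τ : ℝ} (hτ : 0 < τ) {x : σ.Vec} {i : Fin d}
    {t : Fin (σ.dim i)} (hx : 0 ≤ x i t) :
    σ.scale p τ x i t ^ (p i - 1) =
      τ ^ (σ.weight p - 1 / p i) * (τ ^ (1 - σ.weight p) * x i t ^ (p i - 1)) := by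
  have hpi : p i ≠ 0 := (zero_lt_one.trans (hp i)).ne'
  unfold scale
  rw [Real.mul_rpow (Real.rpow_nonneg hτ.le _) hx, ← Real.rpow_mul hτ.le, ← mul_assoc,
    ← Real.rpow_add hτ]
  congr 2
  field_simp
  ring

theorem scale_sub (hp : ∀ i, 1 < p i) {τ : ℝ} (hτ : 0 < τ) {x : σ.Vec} (hx : ∀ i t, 0 ≤ x i t)
    (h : ∀ i t, τ ^ (1 - σ.weight p) * x i t ^ (p i - 1) ≤ σ.G A x i t) (i : Fin d)
    (t : Fin (σ.dim i)) :
    σ.scale p τ x i t ^ (p i - 1) ≤ σ.G A (σ.scale p τ x) i t := by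
  rw [G_scale σ hτ, scale_rpow σ hp hτ (hx i t)]
  exact mul_le_mul_of_nonneg_left (h i t) (Real.rpow_nonneg hτ.le _)

theorem scale_super (hp : ∀ i, 1 < p i) {τ : ℝ} (hτ : 0 < τ) {x : σ.Vec}
    (hx : ∀ i t, 0 ≤ x i t)
    (h : ∀ i t, σ.G A x i t ≤ τ ^ (1 - σ.weight p) * x i t ^ (p i - 1)) (i : Fin d)
    (t : Fin (σ.dim i)) :
    σ.G A (σ.scale p τ x) i t ≤ σ.scale p τ x i t ^ (p i - 1) := by
  rw [G_scale σ hτ, scale_rpow σ hp hτ (hx i t)]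
  exact mul_le_mul_of_nonneg_left (h i t) (Real.rpow_nonneg hτ.le _)

/-- Comparison principle: nonnegative subsolutions of `G x = x ^ (p - 1)` lie below positive
supersolutions. -/
theorem sub_le_super (hA : ∀ k, 0 ≤ A k) (hp : ∀ i, 1 < p i) (hS : σ.weight p < 1)
    {w u : σ.Vec} (hw : ∀ i t, 0 ≤ w i t) (hu : σ.Pos u)
    (hsub : ∀ i t, w i t ^ (p i - 1) ≤ σ.G A w i t)
    (hsup : ∀ i t, σ.G A u i t ≤ u i t ^ (p i - 1)) (i : Fin d) (t : Fin (σ.dim i)) :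
    w i t ≤ u i t := by
  -- The power `p q.1` makes the maximum `θ` the least scaling for which `w` lies below the scaled
  -- `u`, with contact at `(j, s)`.
  obtain ⟨⟨j, s⟩, -, hmax⟩ := Finset.exists_max_image Finset.univ
    (fun q : (i : Fin d) × Fin (σ.dim i) => (w q.1 q.2 / u q.1 q.2) ^ p q.1)
    ⟨⟨i, t⟩, Finset.mem_univ _⟩
  set θ := (w j s / u j s) ^ p j with hθ
  have hp0 : ∀ i, 0 < p i := fun i => zero_lt_one.trans (hp i)
  have hdiv : ∀ i t, 0 ≤ w i t / u i t := fun i t => div_nonneg (hw i t) (hu i t).le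
  have hθ1 : θ ≤ 1 := by
    by_contra! hlt
    have hθ0 : 0 < θ := zero_lt_one.trans hlt
    have hle : ∀ i t, w i t ≤ σ.scale p θ u i t := fun i t => by
      unfold scale
      rw [← div_le_iff₀ (hu i t), ← Real.rpow_le_rpow_iff (hdiv i t)
        (Real.rpow_nonneg hθ0.le _) (hp0 i), ← Real.rpow_mul hθ0.le,
        one_div_mul_cancel (hp0 i).ne', Real.rpow_one]
      exact hmax ⟨i, t⟩ (Finset.mem_univ _)
    have heq : w j s = θ ^ (1 / p j) * u j s := by
      rw [← div_eq_iff (hu j s).ne', hθ, ← Real.rpow_mul (hdiv j s),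
        mul_one_div_cancel (hp0 j).ne', Real.rpow_one]
    -- At the contact point this yields `θ ^ (1 - weight) ≤ 1`, impossible for `θ > 1`.
    have hwu : w j s ^ (p j - 1) ≤ θ ^ (σ.weight p - 1 / p j) * u j s ^ (p j - 1) :=
      calc w j s ^ (p j - 1) ≤ σ.G A w j s := hsub j s
        _ ≤ σ.G A (σ.scale p θ u) j s := σ.G_mono hA hw hle j s
        _ = θ ^ (σ.weight p - 1 / p j) * σ.G A u j s := σ.G_scale hθ0 u j s
        _ ≤ _ := mul_le_mul_of_nonneg_left (hsup j s) (Real.rpow_nonneg hθ0.le _)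
    have hfac := σ.scale_rpow hp hθ0 (hu j s).le
    rw [heq] at hwu
    unfold scale at hfac
    rw [hfac, mul_le_mul_iff_right₀ (Real.rpow_pos_of_pos hθ0 _)] at hwu
    have hupos := Real.rpow_pos_of_pos (hu j s) (p j - 1)
    have h1 : 1 < θ ^ (1 - σ.weight p) := Real.one_lt_rpow hlt (sub_pos.2 hS)
    nlinarith
  have h := (hmax ⟨i, t⟩ (Finset.mem_univ _)).trans hθ1
  rw [← div_le_one (hu i t)]
  by_contra! hlt
  exact absurd h (not_le.2 (Real.one_lt_rpow hlt (hp0 i)))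

/-- The equation `G x = x ^ (p - 1)` has a positive solution. -/
theorem exists_pos_solution (hA : ∀ k, 0 ≤ A k) (hp : ∀ i, 1 < p i)
    (hstrict : σ.StrictlyNonneg A) (hS : σ.weight p < 1) :
    ∃ u, σ.Pos u ∧ ∀ i t, σ.G A u i t = u i t ^ (p i - 1) := by
  have hp0 : ∀ i, 0 < p i := fun i => zero_lt_one.trans (hp i)
  have hS0 : 0 ≤ σ.weight p :=
    Finset.sum_nonneg fun l _ => (one_div_pos.2 (zero_lt_one.trans (hp _))).le
  -- With `z = p log x`, scaling by `τ` is translation of all coordinates by `log τ`, which matches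
  -- the sup distance.
  let e : σ.Vec → σ.Vec := fun z i t => Real.exp (z i t / p i)
  have he : ∀ z, σ.Pos (e z) := fun z i t => Real.exp_pos _
  let T : σ.Vec → σ.Vec := fun z i t => p i / (p i - 1) * Real.log (σ.G A (e z) i t)
  have hlog : ∀ z z' i t, Real.log (σ.G A (e z) i t) ≤
      (σ.weight p - 1 / p i) * dist z z' + Real.log (σ.G A (e z') i t) := fun z z' i t => by
    have hexp := Real.exp_pos (dist z z')
    have hle : ∀ i t, e z i t ≤ σ.scale p (Real.exp (dist z z')) (e z') i t := fun i t => by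
      simp only [e, scale]
      rw [← Real.exp_mul, ← Real.exp_add, Real.exp_le_exp, mul_one_div, ← add_div]
      refine div_le_div_of_nonneg_right ?_ (hp0 i).le
      have h1 : |z i t - z' i t| ≤ dist z z' :=
        (dist_le_pi_dist (z i) (z' i) t).trans (dist_le_pi_dist z z' i)
      linarith [le_abs_self (z i t - z' i t)]
    have hG := σ.G_mono hA (fun i t => (he z i t).le) hle i t
    rw [G_scale σ hexp] at hG
    calc _ ≤ _ := Real.log_le_log (σ.G_pos hA hstrict (he z) i t) hG
      _ = _ := by
        rw [Real.log_mul (Real.rpow_pos_of_pos hexp _).ne'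
          (σ.G_pos hA hstrict (he z') i t).ne', Real.log_rpow hexp, Real.log_exp]
  have hT1 : ∀ z z' i t, T z i t - T z' i t ≤ σ.weight p * dist z z' := fun z z' i t => by
    have hpi : 0 < p i - 1 := sub_pos.2 (hp i)
    have hc : 0 < p i / (p i - 1) := div_pos (hp0 i) hpi
    calc T z i t - T z' i t
        = p i / (p i - 1) * (Real.log (σ.G A (e z) i t) - Real.log (σ.G A (e z') i t)) := by
          simp only [T]; ring
      _ ≤ p i / (p i - 1) * ((σ.weight p - 1 / p i) * dist z z') :=
          mul_le_mul_of_nonneg_left (by linarith [hlog z z' i t]) hc.le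
      _ = (p i / (p i - 1) * (σ.weight p - 1 / p i)) * dist z z' := by ring
      _ ≤ σ.weight p * dist z z' := by
          refine mul_le_mul_of_nonneg_right ?_ dist_nonneg
          -- This quotient is at most `weight` exactly because `weight ≤ 1`.
          have h2 : p i / (p i - 1) * (σ.weight p - 1 / p i) =
              (p i * σ.weight p - 1) / (p i - 1) := by
            have := (hp0 i).ne'
            field_simp
          rw [h2, div_le_iff₀ hpi]
          linarith
  have hT : ContractingWith ⟨σ.weight p, hS0⟩ T := by
    refine ⟨by exact_mod_cast hS, LipschitzWith.of_dist_le_mul fun z z' => ?_⟩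
    have hr : 0 ≤ σ.weight p * dist z z' := mul_nonneg hS0 dist_nonneg
    refine (dist_pi_le_iff hr).2 fun i => (dist_pi_le_iff hr).2 fun t => ?_
    rw [Real.dist_eq, abs_le]
    have h := hT1 z' z i t
    rw [dist_comm] at h
    exact ⟨by linarith, hT1 z z' i t⟩
  have hfix : T (ContractingWith.fixedPoint T hT) = ContractingWith.fixedPoint T hT :=
    hT.fixedPoint_isFixedPt
  generalize ContractingWith.fixedPoint T hT = z at hfix
  refine ⟨e z, he z, fun i t => ?_⟩
  have h := congrFun (congrFun hfix i) t
  have hpi : p i - 1 ≠ 0 := (sub_pos.2 (hp i)).ne'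
  have hpi0 := (hp0 i).ne'
  have hz : Real.log (σ.G A (e z) i t) = z i t / p i * (p i - 1) := by
    simp only [T] at h
    rw [← h]
    field_simp
  rw [← Real.exp_log (σ.G_pos hA hstrict (he z) i t), hz, Real.exp_mul]

end ShapePartition

end SigmaP

/-! ### Positive eigenpairs: existence, maximality, rigidity. -/

namespace SigmaP

variable {m : ℕ} {N : Fin m → ℕ} {d : ℕ} (σ : ShapePartition N d) {A : Tensor N}
  {p : Fin d → ℝ}

open ShapePartition

theorem isEigenpair_iff_of_pos {x : σ.Vec} (hx : σ.Pos x) {lam : ℝ} :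
    IsEigenpair σ A p lam x ↔
      (∀ i t, σ.G A x i t = lam * x i t ^ (p i - 1)) ∧ ∀ i, pNorm (p i) (x i) = 1 := by
  have h : ∀ i t, |x i t| ^ (p i - 1) * Real.sign (x i t) = x i t ^ (p i - 1) := fun i t => by
    rw [abs_of_pos (hx i t), Real.sign_of_pos (hx i t), mul_one]
  simp only [IsEigenpair, h]

theorem exists_pos_rpow_eq {a s : ℝ} (ha : 0 < a) (hs : 0 < s) : ∃ τ : ℝ, 0 < τ ∧ τ ^ s = a :=
  ⟨a ^ (1 / s), Real.rpow_pos_of_pos ha _, by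
    rw [← Real.rpow_mul ha.le, one_div_mul_cancel hs.ne', Real.rpow_one]⟩

theorem exists_pos_eigenpair [Nonempty (Fin d)] (hN : ∀ l, 0 < N l) (hA : ∀ k, 0 ≤ A k)
    (hp : ∀ i, 1 < p i) (hstrict : σ.StrictlyNonneg A) (hS : σ.weight p < 1) :
    ∃ lam x, 0 < lam ∧ σ.Pos x ∧ IsEigenpair σ A p lam x := by
  obtain ⟨u, hu, hGu⟩ := σ.exists_pos_solution hA hp hstrict hS
  have hp0 : ∀ i, 0 < p i := fun i => zero_lt_one.trans (hp i)
  -- The sums `∑ t, u i t ^ p i` share one value `ρ` over all blocks, so the single scaling by `ρ⁻¹`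
  -- normalizes every block at once.
  have hform : ∀ i, ∑ t, u i t ^ p i = ∑ k, A k * ∏ l, σ.lift u l (k l) := fun i => by
    rw [← σ.sum_mul_G A u i]
    refine Finset.sum_congr rfl fun t _ => ?_
    rw [hGu, Real.rpow_sub_one (hu i t).ne', mul_div_cancel₀ _ (hu i t).ne']
  set ρ := ∑ k, A k * ∏ l, σ.lift u l (k l)
  have hρ : 0 < ρ := by
    rw [← hform (Classical.arbitrary _)]
    exact sum_rpow_pos (hN _) (hu _)
  have hρi := inv_pos.2 hρ
  refine ⟨ρ ^ (1 - σ.weight p), σ.scale p ρ⁻¹ u, Real.rpow_pos_of_pos hρ _,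
    σ.scale_pos hρi hu, (isEigenpair_iff_of_pos σ (σ.scale_pos hρi hu)).2
      ⟨fun i t => ?_, fun i => ?_⟩⟩
  · rw [σ.G_scale hρi, hGu, σ.scale_rpow hp hρi (hu i t).le, Real.inv_rpow hρ.le (1 - _)]
    have := (Real.rpow_pos_of_pos hρ (1 - σ.weight p)).ne'
    field_simp
  · change pNorm (p i) (fun t => ρ⁻¹ ^ (1 / p i) * u i t) = 1
    rw [pNorm_smul (hp0 i) (Real.rpow_nonneg hρi.le _), pNorm_eq_of_pos _ (hu i), hform,
      ← Real.mul_rpow hρi.le hρ.le, inv_mul_cancel₀ hρ.ne', Real.one_rpow]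

section PosEigenpair

variable {xbar : σ.Vec} {lam : ℝ}

/-- The absolute value of an eigenvalue is at most the eigenvalue of a positive eigenvector. -/
theorem abs_eigenvalue_le [Nonempty (Fin d)] (hA : ∀ k, 0 ≤ A k) (hp : ∀ i, 1 < p i)
    (hS : σ.weight p < 1) (hlam : 0 < lam) (hxbar : σ.Pos xbar)
    (heig : IsEigenpair σ A p lam xbar) {μ : ℝ} {x : σ.Vec} (hx : IsEigenpair σ A p μ x) :
    |μ| ≤ lam := by
  rcases eq_or_ne μ 0 with rfl | hμ
  · simpa using hlam.le
  have hs := sub_pos.2 hS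
  obtain ⟨ρ, hρ, rfl⟩ := exists_pos_rpow_eq hlam hs
  obtain ⟨τ, hτ, hτμ⟩ := exists_pos_rpow_eq (abs_pos.2 hμ) hs
  have hp0 : ∀ i, 0 < p i := fun i => zero_lt_one.trans (hp i)
  rw [isEigenpair_iff_of_pos σ hxbar] at heig
  -- Here `|μ| |x| ^ (p - 1) = |G x| ≤ G |x|`; comparison and the unit norms then give `τ ≤ ρ`.
  have hle := σ.sub_le_super (w := σ.scale p τ fun i t => |x i t|) hA hp hS
    (fun i t => mul_nonneg (Real.rpow_nonneg hτ.le _) (abs_nonneg _))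
    (σ.scale_pos hρ hxbar)
    (σ.scale_sub hp hτ (fun i t => abs_nonneg _) fun i t => by
      refine le_trans (le_of_eq ?_) (σ.abs_G_le hA x i t)
      rw [hx.1 i t, hτμ, abs_mul, abs_mul, abs_of_nonneg (Real.rpow_nonneg (abs_nonneg _) _)]
      rcases lt_trichotomy (x i t) 0 with h | h | h
      · simp [Real.sign_of_neg h]
      · simp [h, Real.zero_rpow (sub_pos.2 (hp i)).ne']
      · simp [Real.sign_of_pos h])
    (σ.scale_super hp hρ (fun i t => (hxbar i t).le) fun i t => (heig.1 i t).le)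
  have i := Classical.arbitrary (Fin d)
  have hnorm := pNorm_mono (hp0 i)
    (fun t => mul_nonneg (Real.rpow_nonneg hτ.le _) (abs_nonneg _)) (hle i)
  change pNorm (p i) (fun t => τ ^ (1 / p i) * |x i t|) ≤
    pNorm (p i) (fun t => ρ ^ (1 / p i) * xbar i t) at hnorm
  rw [pNorm_smul (hp0 i) (Real.rpow_nonneg hτ.le _), pNorm_smul (hp0 i)
    (Real.rpow_nonneg hρ.le _), pNorm_abs, hx.2, heig.2, mul_one, mul_one,
    Real.rpow_le_rpow_iff hτ.le hρ.le (one_div_pos.2 (hp0 i))] at hnorm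
  rw [← hτμ]
  exact Real.rpow_le_rpow hτ.le hnorm hs.le

/-- A feasible point that is a supersolution for the eigenvalue of a positive eigenvector
equals that eigenvector. -/
theorem eq_of_feasible_of_le (hA : ∀ k, 0 ≤ A k) (hp : ∀ i, 1 < p i)
    (hS : σ.weight p < 1) (hlam : 0 < lam) (hxbar : σ.Pos xbar)
    (heig : IsEigenpair σ A p lam xbar) {x : σ.Vec} (hx : x ∈ feasible σ p)
    (hle : ∀ i t, σ.G A x i t ≤ lam * x i t ^ (p i - 1)) : x = xbar := by
  obtain ⟨hx, hc⟩ := hx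
  obtain ⟨ρ, hρ, rfl⟩ := exists_pos_rpow_eq hlam (sub_pos.2 hS)
  have hp0 : ∀ i, 0 < p i := fun i => zero_lt_one.trans (hp i)
  rw [isEigenpair_iff_of_pos σ hxbar] at heig
  have hge : ∀ i t, xbar i t ≤ x i t := fun i t => by
    have h := σ.sub_le_super hA hp hS (fun i t => (σ.scale_pos hρ hxbar i t).le)
      (σ.scale_pos hρ hx)
      (σ.scale_sub hp hρ (fun i t => (hxbar i t).le) fun i t => (heig.1 i t).ge)
      (σ.scale_super hp hρ (fun i t => (hx i t).le) hle) i t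
    exact le_of_mul_le_mul_left h (Real.rpow_pos_of_pos hρ _)
  have hnorm : ∀ i, 1 ≤ pNorm (p i) (x i) := fun i => by
    rw [← heig.2 i]
    exact pNorm_mono (hp0 i) (fun t => (hxbar i t).le) (hge i)
  -- All factors of `c(x)` are at least 1, so each is bounded by the product.
  have hnorm1 : ∀ i, pNorm (p i) (x i) ≤ 1 := fun i => by
    refine le_trans ?_ hc
    rw [cFun, ← Finset.mul_prod_erase _ _ (Finset.mem_univ i)]
    refine le_mul_of_one_le_right (zero_le_one.trans (hnorm i)) ?_
    calc (1 : ℝ) = ∏ j ∈ Finset.univ.erase i, 1 := by simp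
      _ ≤ _ := Finset.prod_le_prod (fun _ _ => zero_le_one) fun j _ => hnorm j
  ext i t
  by_contra hne
  have hlt := pNorm_lt_pNorm (hp0 i) (fun t => (hxbar i t).le) (hge i)
    (lt_of_le_of_ne (hge i t) (Ne.symm hne))
  rw [heig.2 i] at hlt
  exact absurd (hnorm1 i) (not_le.2 hlt)

theorem IsEigenpair.mem_feasible (hxbar : σ.Pos xbar) (heig : IsEigenpair σ A p lam xbar) :
    xbar ∈ feasible σ p :=
  ⟨hxbar, by simp [cFun, heig.2]⟩

/-- The eigenvector with the smaller eigenvalue is a feasible supersolution for the larger one, so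
the two coincide. -/
theorem eq_of_isPosEigenvector (hA : ∀ k, 0 ≤ A k) (hp : ∀ i, 1 < p i)
    (hS : σ.weight p < 1) {z : σ.Vec} (hlam : 0 < lam) (hxbar : σ.Pos xbar)
    (heig : IsEigenpair σ A p lam xbar) {μ : ℝ} (hμ : 0 < μ) (hz : σ.Pos z)
    (hzeig : IsEigenpair σ A p μ z) : z = xbar := by
  have hG := ((isEigenpair_iff_of_pos σ hz).1 hzeig).1
  have hG' := ((isEigenpair_iff_of_pos σ hxbar).1 heig).1
  rcases le_total μ lam with h | h
  · exact eq_of_feasible_of_le σ hA hp hS hlam hxbar heig (hzeig.mem_feasible σ hz)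
      fun i t => (hG i t).trans_le
        (mul_le_mul_of_nonneg_right h (Real.rpow_nonneg (hz i t).le _))
  · exact (eq_of_feasible_of_le σ hA hp hS hμ hz hzeig (heig.mem_feasible σ hxbar)
      fun i t => (hG' i t).trans_le
        (mul_le_mul_of_nonneg_right h (Real.rpow_nonneg (hxbar i t).le _))).symm

theorem IsEigenpair.Phi_eq (hxbar : σ.Pos xbar) (heig : IsEigenpair σ A p lam xbar) (i : Fin d)
    (t : Fin (σ.dim i)) : Phi σ A p xbar i t = lam := by
  rw [Phi, ((isEigenpair_iff_of_pos σ hxbar).1 heig).1,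
    mul_div_cancel_right₀ _ (Real.rpow_pos_of_pos (hxbar i t) _).ne']

end PosEigenpair

/-! ### The logarithmic change of variables and convexity. -/

theorem Phi_le_iff {x : σ.Vec} (hx : σ.Pos x) {a : ℝ} {i : Fin d} {t : Fin (σ.dim i)} :
    Phi σ A p x i t ≤ a ↔ σ.G A x i t ≤ a * x i t ^ (p i - 1) :=
  div_le_iff₀ (Real.rpow_pos_of_pos (hx i t) _)

theorem Phi_le_phi (x : σ.Vec) (i : Fin d) (t : Fin (σ.dim i)) :
    Phi σ A p x i t ≤ phi σ A p x :=
  le_ciSup (f := fun q : (i : Fin d) × Fin (σ.dim i) => Phi σ A p x q.1 q.2)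
    (Set.finite_range _).bddAbove ⟨i, t⟩

theorem Phi_pos (hA : ∀ k, 0 ≤ A k) (hstrict : σ.StrictlyNonneg A) {x : σ.Vec} (hx : σ.Pos x)
    (i : Fin d) (t : Fin (σ.dim i)) : 0 < Phi σ A p x i t :=
  div_pos (σ.G_pos hA hstrict hx i t) (Real.rpow_pos_of_pos (hx i t) _)

theorem vexp_pos (y : σ.Vec) : σ.Pos (vexp σ y) := fun _ _ => Real.exp_pos _

theorem cFun_pos (hN : ∀ l, 0 < N l) {x : σ.Vec} (hx : σ.Pos x) : 0 < cFun σ p x :=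
  Finset.prod_pos fun i _ => pNorm_pos (hN _) (hx i)

theorem vlog_vexp (y : σ.Vec) : vlog σ (vexp σ y) = y := by
  ext i t
  exact Real.log_exp _

theorem vexp_vlog {x : σ.Vec} (hx : σ.Pos x) : vexp σ (vlog σ x) = x := by
  ext i t
  exact Real.exp_log (hx i t)

/-- The exponential change of variables transforms one feasible set into the other. -/
theorem mem_logFeasible_iff (hN : ∀ l, 0 < N l) (hA : ∀ k, 0 ≤ A k)
    (hstrict : σ.StrictlyNonneg A) (w : σ.Vec × ℝ) :
    w ∈ logFeasible σ A p ↔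
      (∀ i t, Phi σ A p (vexp σ w.1) i t ≤ Real.exp w.2) ∧ vexp σ w.1 ∈ feasible σ p := by
  have hpos := vexp_pos σ w.1
  refine and_congr (forall₂_congr fun i t => ?_) ?_
  · rw [sub_nonpos]
    exact Real.log_le_iff_le_exp (Phi_pos σ hA hstrict hpos i t)
  · rw [feasible, Set.mem_ofPred_eq, and_iff_right hpos, logC,
      Real.log_nonpos_iff (cFun_pos σ hN hpos).le]

/-- Dividing by `x ^ (p - 1)` only subtracts a linear form from a log-sum-exp. -/
theorem convexOn_logPhi (hA : ∀ k, 0 ≤ A k) (hstrict : σ.StrictlyNonneg A) (i : Fin d)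
    (t : Fin (σ.dim i)) : ConvexOn ℝ Set.univ (fun y : σ.Vec => logPhi σ A p y i t) := by
  let E : (i : Fin d) → Fin (σ.dim i) → σ.Vec →ₗ[ℝ] ℝ :=
    fun i t => LinearMap.proj t ∘ₗ LinearMap.proj i
  let L : (∀ l, Fin (N l)) → σ.Vec →ₗ[ℝ] ℝ := fun k =>
    ∑ l ∈ Finset.univ.erase (σ.first i), E (σ.blockOf l) (Fin.cast (σ.dim_blockOf l) (k l))
  have hL : ∀ k (y : σ.Vec), Real.exp (L k y) =
      ∏ l ∈ Finset.univ.erase (σ.first i), σ.lift (vexp σ y) l (k l) := fun k y => by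
    simp only [L, LinearMap.sum_apply, Real.exp_sum]
    rfl
  have hG : ∀ y : σ.Vec, σ.G A (vexp σ y) i t =
      ∑ k : (∀ l, Fin (N l)) with k (σ.first i) = (show Fin (N (σ.first i)) from t),
        A k * Real.exp (L k y) := fun y => by
    simp_rw [hL]
    rfl
  have hlse := convexOn_log_sum_exp _ A (fun k _ => hA k) L fun y =>
    (σ.G_pos hA hstrict (vexp_pos σ y) i t).trans_eq (hG y)
  have heq : (fun y : σ.Vec => logPhi σ A p y i t) =
      (fun y => Real.log (∑ k : (∀ l, Fin (N l)) with
        k (σ.first i) = (show Fin (N (σ.first i)) from t), A k * Real.exp (L k y))) -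
        ⇑((p i - 1) • E i t) := by
    funext y
    rw [logPhi, Phi, Real.log_div (σ.G_pos hA hstrict (vexp_pos σ y) i t).ne'
      (Real.rpow_pos_of_pos (vexp_pos σ y i t) _).ne', Real.log_rpow (vexp_pos σ y i t), hG]
    simp [vexp, E]
  rw [heq]
  exact hlse.sub (((p i - 1) • E i t).concaveOn convex_univ)

theorem convexOn_logC (hN : ∀ l, 0 < N l) (hp : ∀ i, 1 < p i) :
    ConvexOn ℝ Set.univ (logC σ p) := by
  have hp0 : ∀ i, 0 < p i := fun i => zero_lt_one.trans (hp i)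
  let L : (i : Fin d) → Fin (σ.dim i) → σ.Vec →ₗ[ℝ] ℝ :=
    fun i t => p i • ((LinearMap.proj t : (Fin (σ.dim i) → ℝ) →ₗ[ℝ] ℝ) ∘ₗ LinearMap.proj i)
  have hL : ∀ i (y : σ.Vec), ∑ t, 1 * Real.exp (L i t y) = ∑ t, vexp σ y i t ^ p i :=
    fun i y => Finset.sum_congr rfl fun t _ => by
      rw [one_mul, vexp, ← Real.exp_mul, mul_comm]
      rfl
  have hpos : ∀ i (y : σ.Vec), 0 < ∑ t, vexp σ y i t ^ p i := fun i y =>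
    sum_rpow_pos (hN _) (vexp_pos σ y i)
  have hlse : ∀ i, ConvexOn ℝ Set.univ
      fun y : σ.Vec => 1 / p i * Real.log (∑ t, vexp σ y i t ^ p i) := fun i => by
    have h := convexOn_log_sum_exp Finset.univ (fun _ => (1 : ℝ)) (fun _ _ => zero_le_one) (L i)
      fun y => (hpos i y).trans_eq (hL i y).symm
    simp_rw [hL] at h
    exact h.smul (one_div_pos.2 (hp0 i)).le
  have hsum : logC σ p = fun y => ∑ i, 1 / p i * Real.log (∑ t, vexp σ y i t ^ p i) := by
    ext y
    rw [logC, cFun, Real.log_prod (f := fun i => pNorm (p i) (vexp σ y i)) fun i _ =>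
      (pNorm_pos (hN _) (vexp_pos σ y i)).ne']
    refine Finset.sum_congr rfl fun i _ => ?_
    rw [pNorm_eq_of_pos _ (vexp_pos σ y i), Real.log_rpow (hpos i y)]
  rw [hsum]
  refine ⟨convex_univ, fun y hy z hz a b ha hb hab => ?_⟩
  simp only [Finset.smul_sum]
  rw [← Finset.sum_add_distrib]
  exact Finset.sum_le_sum fun i _ => (hlse i).2 hy hz ha hb hab

end SigmaP

/-! ### Assembly of the theorem. -/

theorem mainTheorem2 {m d : ℕ} (hm : 0 < m) (N : Fin m → ℕ) (hN : ∀ l, 0 < N l)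
    (A : SigmaP.Tensor N) (hA : ∀ k, 0 ≤ A k)
    (σ : SigmaP.ShapePartition N d) (p : Fin d → ℝ) (hp : ∀ i, 1 < p i)
    (hstrict : σ.StrictlyNonneg A)
    (hsum : ∑ i, ((σ.block i).card : ℝ) / p i < 1) :
    -- the supremum defining the spectral radius is a genuine supremum, and it is positive
    IsLUB (SigmaP.absEigenvalues σ A p) (SigmaP.spectralRadius σ A p) ∧
    0 < SigmaP.spectralRadius σ A p ∧
    -- the log-transformed problem is a convex program
    (∀ i t, ConvexOn ℝ Set.univ (fun y : σ.Vec => SigmaP.logPhi σ A p y i t)) ∧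
    ConvexOn ℝ Set.univ (SigmaP.logC σ p) ∧
    -- there is a unique positive eigenvector, and it gives the unique solutions
    ∃ xbar : σ.Vec,
      SigmaP.IsPosEigenvector σ A p xbar ∧
      (∀ z : σ.Vec, SigmaP.IsPosEigenvector σ A p z → z = xbar) ∧
      (∀ x : σ.Vec,
        SigmaP.IsSolution (SigmaP.phi σ A p) (SigmaP.feasible σ p) x ↔ x = xbar) ∧
      SigmaP.phi σ A p xbar = SigmaP.spectralRadius σ A p ∧
      (∀ w : σ.Vec × ℝ,
        SigmaP.IsSolution (fun v : σ.Vec × ℝ => v.2) (SigmaP.logFeasible σ A p) w ↔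
          w = (SigmaP.vlog σ xbar, Real.log (SigmaP.spectralRadius σ A p))) := by
  have hd : Nonempty (Fin d) := ⟨σ.blockOf ⟨0, hm⟩⟩
  have hS : σ.weight p < 1 := (σ.weight_eq p).trans_lt hsum
  obtain ⟨lam, xbar, hlam, hpos, heig⟩ := SigmaP.exists_pos_eigenpair σ hN hA hp hstrict hS
  have hlub : IsGreatest (SigmaP.absEigenvalues σ A p) lam :=
    ⟨⟨lam, xbar, heig, (abs_of_pos hlam).symm⟩, by
      rintro _ ⟨μ, x, hx, rfl⟩
      exact SigmaP.abs_eigenvalue_le σ hA hp hS hlam hpos heig hx⟩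
  have hr : SigmaP.spectralRadius σ A p = lam := hlub.isLUB.csSup_eq hlub.nonempty
  let q₀ : (i : Fin d) × Fin (σ.dim i) := ⟨Classical.arbitrary _, ⟨0, hN _⟩⟩
  have hne : Nonempty ((i : Fin d) × Fin (σ.dim i)) := ⟨q₀⟩
  have hPhi := heig.Phi_eq σ hpos
  have hphi : SigmaP.phi σ A p xbar = lam := by
    simp only [SigmaP.phi, hPhi, ciSup_const]
  have hfeas := heig.mem_feasible σ hpos
  have huniq : ∀ x ∈ SigmaP.feasible σ p, (∀ i t, SigmaP.Phi σ A p x i t ≤ lam) → x = xbar :=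
    fun x hx h => SigmaP.eq_of_feasible_of_le σ hA hp hS hlam hpos heig hx
      fun i t => (SigmaP.Phi_le_iff σ hx.1).1 (h i t)
  have huniq_phi : ∀ x ∈ SigmaP.feasible σ p, SigmaP.phi σ A p x ≤ lam → x = xbar :=
    fun x hx h => huniq x hx fun i t => (SigmaP.Phi_le_phi σ x i t).trans h
  have hlog : (SigmaP.vlog σ xbar, Real.log lam) ∈ SigmaP.logFeasible σ A p := by
    rw [SigmaP.mem_logFeasible_iff σ hN hA hstrict]
    simp only [SigmaP.vexp_vlog σ hpos, Real.exp_log hlam]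
    exact ⟨fun i t => (hPhi i t).le, hfeas⟩
  have huniq_log : ∀ w ∈ SigmaP.logFeasible σ A p, w.2 ≤ Real.log lam →
      w = (SigmaP.vlog σ xbar, Real.log lam) := fun w hw hle => by
    rw [SigmaP.mem_logFeasible_iff σ hN hA hstrict] at hw
    have hexp : Real.exp w.2 ≤ lam := (Real.le_log_iff_exp_le hlam).1 hle
    have hx := huniq _ hw.2 fun i t => (hw.1 i t).trans hexp
    -- All `Φ` equal `lam` at `xbar`, so any one constraint bounds `w.2` below by `log lam`.
    have hge := hw.1 q₀.1 q₀.2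
    rw [hx, hPhi] at hge
    refine Prod.ext ?_ (le_antisymm hle ((Real.log_le_iff_le_exp hlam).2 hge))
    rw [← hx, SigmaP.vlog_vexp]
  rw [hr]
  refine ⟨hlub.isLUB, hlam, SigmaP.convexOn_logPhi σ hA hstrict, SigmaP.convexOn_logC σ hN hp,
    xbar, ⟨hpos, lam, heig⟩, ?_, fun x => ⟨fun hx => ?_, ?_⟩, hphi, fun w => ⟨fun hw => ?_, ?_⟩⟩
  · rintro z ⟨hz, μ, hzeig⟩
    have hμ : 0 < μ := by
      have h := σ.G_pos hA hstrict hz q₀.1 q₀.2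
      rw [((SigmaP.isEigenpair_iff_of_pos σ hz).1 hzeig).1] at h
      exact pos_of_mul_pos_left h (Real.rpow_nonneg (hz _ _).le _)
    exact SigmaP.eq_of_isPosEigenvector σ hA hp hS hlam hpos heig hμ hz hzeig
  · exact huniq_phi x hx.1 ((hx.2 _ hfeas).trans hphi.le)
  · rintro rfl
    refine ⟨hfeas, fun z hz => ?_⟩
    rw [hphi]
    -- A strictly better point would be `xbar` itself by rigidity.
    by_contra! hlt
    rw [huniq_phi z hz hlt.le, hphi] at hlt
    exact hlt.false
  · exact huniq_log w hw.1 (hw.2 _ hlog)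
  · rintro rfl
    refine ⟨hlog, fun z hz => ?_⟩
    by_contra! hlt
    have hlt' : z.2 < Real.log lam := hlt
    rw [huniq_log z hz hlt'.le] at hlt'
    exact hlt'.false
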